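/- Let $K$ be a non-archimedean local field with $\mathrm{char}(K) \neq 2$, let $\pi\colon \mathrm{SL}_2(K) \to \mathrm{PSL}_2(K) = \mathrm{SL}_2(K)/\{\pm I\}$ be the canonical projection, and let $G$ be a discrete subgroup of $\mathrm{PSL}_2(K)$, where $\mathrm{PSL}_2(K)$ carries the quotient of the topology that $\mathrm{SL}_2(K)$ inherits from $K$. Then $G$ lifts to $\mathrm{SL}_2(K)$, that is, there exists a group homomorphism $\phi\colon G \to \mathrm{SL}_2(K)$ such that $\pi\circ\phi$ is the identity on $G$, if and only if $G$ has no $2$-torsion, that is, $G$ contains no element of order $2$. -/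

import Mathlib

open scoped MatrixGroups

/-- A subgroup `G` of `Γ₂` lifts along a group homomorphism `π : Γ₁ → Γ₂` if there is a group
homomorphism `φ : G → Γ₁` such that `π ∘ φ` is the identity on `G`. -/
def LiftsAlong {Γ₁ Γ₂ : Type*} [Group Γ₁] [Group Γ₂] (π : Γ₁ →* Γ₂) (G : Subgroup Γ₂) : Prop :=
  ∃ φ : G →* Γ₁, ∀ g : G, π (φ g) = (g : Γ₂)

/-- The canonical projection from `SL(2, K)` onto `PSL(2, K)`, its quotient by the centre. -/
def projSL (K : Type*) [Field K] : SL(2, K) →* PSL(2, K) :=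
  QuotientGroup.mk' (Subgroup.center SL(2, K))

/-- A subgroup has no `2`-torsion if it contains no element of order two. -/
def HasNoTwoTorsion {Γ : Type*} [Group Γ] (G : Subgroup Γ) : Prop :=
  ∀ g ∈ G, orderOf g ≠ 2

/-! A lift sends an involution to a nontrivial element of square 1 in SL₂(K), hence to -1, which
projects to 1; this excludes 2-torsion (`LiftsAlong.hasNoTwoTorsion`).

Conversely, let Γ be the preimage of G. A lift of G amounts to a complement of {1, -1} in Γ, and the
kernel of a character χ : Γ → {1, -1} with χ(-1) = -1 is one (`liftsAlong_of_character`). Without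
2-torsion in G, every torsion element of Γ has an odd power equal to 1 or -1. In a finite subgroup
containing -1, the sign that separates odd order from even order is then a character
(`oddOrderSign_mul`, via the transfer to the centre).

Γ is discrete, so it acts on the Bruhat-Tits tree of SL₂(K) with finite vertex stabilizers
(`finite_stabilizer`). The signs on the stabilizers come from one function on Γ, so they agree on
edge stabilizers, and contractibility of the tree glues them to a character of Γ
(`exists_character_of_tree`). The tree is built by hand from lattices of covolume 1 or ϖ: a normal
form gives each lattice its height above O², and lowering the height is possible in exactly one way.
-/

/-! ### Gluing characters along a tree. -/

/-- A conjugation-invariant function to `ℤˣ` which is multiplicative on the vertex stabilizers of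
an action on a rooted tree extends from these stabilizers to a character of the whole group. The
tree is given by its oriented edges `R` and a height function such that every vertex except the
root has exactly one lower neighbour. -/
theorem exists_character_of_tree {Γ V : Type*} [Group Γ] [MulAction Γ V] (s : Γ → ℤˣ)
    (hconj : ∀ g h, s (h * g * h⁻¹) = s g)
    (hmul : ∀ (v : V) (g h : Γ), g • v = v → h • v = v → s (g * h) = s g * s h)
    (R : V → V → Prop) (hR : ∀ (g : Γ) v w, R v w → R (g • v) (g • w))
    (hasymm : ∀ v w, R v w → ¬ R w v)
    (ht : V → ℕ) (hroot : ∀ v w, ht v = 0 → ht w = 0 → v = w)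
    (hlower : ∀ v, ht v ≠ 0 → ∃ w, (R v w ∨ R w v) ∧ ht w < ht v)
    (huniq : ∀ v w w', (R v w ∨ R w v) → (R v w' ∨ R w' v) → ht w < ht v → ht w' < ht v → w = w')
    (hne : ∀ v w, R v w → ht v ≠ ht w) :
    ∃ χ : Γ →* ℤˣ, ∀ (v : V) (g : Γ), g • v = v → χ g = s g := by
  classical
  have sq : ∀ x : ℤˣ, x * x = 1 := Int.units_mul_self
  -- orbit representatives on vertices
  have orbitRep : ∀ (X : Type _) [MulAction Γ X], ∃ (r : X → X) (t : X → Γ),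
      (∀ x, t x • r x = x) ∧ ∀ (g : Γ) x, r (g • x) = r x := by
    intro X _
    let r : X → X := fun x => (Quotient.mk (MulAction.orbitRel Γ X) x).out
    have h : ∀ x, ∃ g : Γ, g • r x = x := fun x =>
      (MulAction.orbitRel Γ X).symm (Quotient.mk_out (s := MulAction.orbitRel Γ X) x)
    choose t ht using h
    refine ⟨r, t, ht, fun g x => ?_⟩
    have : Quotient.mk (MulAction.orbitRel Γ X) (g • x) = Quotient.mk (MulAction.orbitRel Γ X) x :=
      Quotient.sound ⟨g, rfl⟩
    simp only [r, this]
  obtain ⟨r, t, htr, hrg⟩ := orbitRep V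
  have htinv : ∀ v, (t v)⁻¹ • v = r v := fun v => by rw [inv_smul_eq_iff, htr]
  have htg : ∀ (g : Γ) v, (t (g • v))⁻¹ • g • v = r v := fun g v => by rw [htinv, hrg]
  -- A 1-cocycle with values in functions on the vertices, induced from the characters `s` of the
  -- stabilizers of the orbit representatives.
  let c : Γ → V → ℤˣ := fun g v => s ((t (g • v))⁻¹ * g * t v)
  have hc_mul : ∀ g h v, c (g * h) v = c g (h • v) * c h v := by
    intro g h v
    simp only [c]
    rw [← hmul (r v)]
    · congr 1
      rw [mul_smul]
      group
    · rw [mul_smul, mul_smul, ← hrg h v, htr, htg]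
    · rw [mul_smul, mul_smul, htr, htg]
  have hc_stab : ∀ g v, g • v = v → c g v = s g := by
    intro g v h
    simp only [c, h]
    simpa using hconj g (t v)⁻¹
  obtain ⟨r₂, t₂, htr₂, hrg₂⟩ := orbitRep (V × V)
  -- On the stabilizer of a pair, the product of the two values of `c` is `s k * s k = 1`. Hence
  -- that product is a coboundary on each orbit of pairs, and `D` is a primitive of it.
  let D : V × V → ℤˣ := fun e => c (t₂ e) (r₂ e).1 * c (t₂ e) (r₂ e).2
  have hD : ∀ g v w, D (g • (v, w)) = D (v, w) * (c g v * c g w) := by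
    intro g v w
    obtain ⟨k, hk⟩ : ∃ k, t₂ (g • (v, w)) = g * t₂ (v, w) * k :=
      ⟨(g * t₂ (v, w))⁻¹ * t₂ (g • (v, w)), by group⟩
    have h1 := htr₂ (v, w)
    have h2 := htr₂ (g • (v, w))
    have hkfix : k • r₂ (v, w) = r₂ (v, w) := by
      rw [hrg₂, hk, mul_smul, mul_smul] at h2
      have h3 := (MulAction.injective g) h2
      exact MulAction.injective (t₂ (v, w)) (h3.trans h1.symm)
    have hk1 : k • (r₂ (v, w)).1 = (r₂ (v, w)).1 := congrArg Prod.fst hkfix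
    have hk2 : k • (r₂ (v, w)).2 = (r₂ (v, w)).2 := congrArg Prod.snd hkfix
    have h1a : t₂ (v, w) • (r₂ (v, w)).1 = v := congrArg Prod.fst h1
    have h1b : t₂ (v, w) • (r₂ (v, w)).2 = w := congrArg Prod.snd h1
    simp only [D]
    rw [hrg₂, hk, hc_mul, hc_mul _ k, hk1, hk2, hc_mul, hc_mul g, h1a, h1b, hc_stab k _ hk1,
      hc_stab k _ hk2]
    calc _ = c (t₂ (v, w)) (r₂ (v, w)).1 * c (t₂ (v, w)) (r₂ (v, w)).2 * (c g v * c g w)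
          * (s k * s k) := by ac_rfl
      _ = _ := by rw [sq, mul_one]
  choose! p hp using hlower
  -- `D (v, w)` and `D (w, v)` are normalized independently, so each edge is read in its orientation
  -- by `R`.
  let e : V → V → ℤˣ := fun v w => if R v w then D (v, w) else D (w, v)
  -- Integration of the edge function outward from the root. Stage `m + 1` changes only the vertices
  -- of height `m + 1`, so a value is final once its height is reached.
  obtain ⟨f, hf⟩ : ∃ f : V → ℤˣ, ∀ v, ht v ≠ 0 → f v = f (p v) * e v (p v) := by
    let F : ℕ → V → ℤˣ := fun n => Nat.rec (fun _ => 1)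
      (fun m f v => if ht v = m + 1 then f (p v) * e v (p v) else f v) n
    have hFs : ∀ n v, F (n + 1) v = if ht v = n + 1 then F n (p v) * e v (p v) else F n v :=
      fun n v => rfl
    have hstable : ∀ n v, ht v ≤ n → F n v = F (ht v) v := by
      intro n v h
      induction n, h using Nat.le_induction with
      | base => rfl
      | succ n h ih => rw [hFs, if_neg (by omega), ih]
    refine ⟨fun v => F (ht v) v, fun v hv => ?_⟩
    have hlt := (hp v hv).2
    obtain ⟨m, hm⟩ := Nat.exists_eq_succ_of_ne_zero hv
    simp only
    rw [hm, Nat.succ_eq_add_one, hFs, if_pos hm, hstable m (p v) (by omega)]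
  have hfD : ∀ v w, R v w → f v * f w = D (v, w) := by
    intro v w h
    rcases lt_or_gt_of_ne (hne v w h) with hlt | hlt
    · have h0 : ht w ≠ 0 := by omega
      have hpw : p w = v := huniq w _ _ (hp w h0).1 (.inr h) (hp w h0).2 hlt
      rw [hf w h0, hpw, ← mul_assoc, sq, one_mul]
      exact if_neg (hasymm _ _ h)
    · have h0 : ht v ≠ 0 := by omega
      have hpv : p v = w := huniq v _ _ (hp v h0).1 (.inl h) (hp v h0).2 hlt
      rw [hf v h0, hpv, mul_right_comm, sq, one_mul]
      exact if_pos h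
  -- Twisting `c` by the coboundary of `f` makes it constant along edges, hence independent of the
  -- vertex: a cocycle of constants is a character.
  let X : Γ → V → ℤˣ := fun g v => c g v * f v * f (g • v)
  have hXR : ∀ g v w, R v w → X g v = X g w := by
    intro g v w h
    have h1 := hfD _ _ h
    have h2 : f (g • v) * f (g • w) = D (v, w) * (c g v * c g w) :=
      (hfD _ _ (hR g v w h)).trans (hD g v w)
    have h3 : X g v * X g w = 1 := by
      calc X g v * X g w = (c g v * c g w) * (f v * f w) * (f (g • v) * f (g • w)) := by
            simp only [X]; ac_rfl
        _ = ((c g v * c g w) * (c g v * c g w)) * (D (v, w) * D (v, w)) := by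
            rw [h1, h2]; ac_rfl
        _ = 1 := by rw [sq, sq, one_mul]
    calc X g v = X g v * (X g w * X g w) := by rw [sq, mul_one]
      _ = X g w := by rw [← mul_assoc, h3, one_mul]
  have hX : ∀ g v w, X g v = X g w := by
    intro g
    have descend : ∀ n v, ht v ≤ n → ∃ u, ht u = 0 ∧ X g v = X g u := by
      intro n
      induction n with
      | zero => exact fun v h => ⟨v, by omega, rfl⟩
      | succ n ih =>
        intro v h
        by_cases h0 : ht v = 0
        · exact ⟨v, h0, rfl⟩
        · obtain ⟨hadj, hlt⟩ := hp v h0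
          obtain ⟨u, hu, hu'⟩ := ih (p v) (by omega)
          refine ⟨u, hu, Eq.trans ?_ hu'⟩
          rcases hadj with h1 | h1
          · exact hXR g _ _ h1
          · exact (hXR g _ _ h1).symm
    intro v w
    obtain ⟨u, hu, hvu⟩ := descend _ v le_rfl
    obtain ⟨u', hu', hwu⟩ := descend _ w le_rfl
    rw [hvu, hwu, hroot u u' hu hu']
  have hX_mul : ∀ g h v, X (g * h) v = X g v * X h v := by
    intro g h v
    rw [hX g v (h • v)]
    simp only [X]
    rw [hc_mul, mul_smul]
    calc _ = c g (h • v) * c h v * f v * f (g • h • v) * 1 := by rw [mul_one]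
      _ = c g (h • v) * c h v * f v * f (g • h • v) * (f (h • v) * f (h • v)) := by rw [sq]
      _ = _ := by ac_rfl
  rcases isEmpty_or_nonempty V with hV | ⟨⟨v₀⟩⟩
  · exact ⟨1, fun v => hV.elim v⟩
  · refine ⟨MonoidHom.mk' (fun g => X g v₀) fun g h => hX_mul g h v₀, fun v g h => ?_⟩
    change X g v₀ = s g
    rw [hX g v₀ v]
    simp only [X]
    rw [h, mul_assoc, sq, mul_one, hc_stab g v h]

/-! ### The odd-order sign on finite groups. -/

open Classical in
/-- The sign of a group element: `1` if it has odd order, and `-1` otherwise. -/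
noncomputable def oddOrderSign {Γ : Type*} [Group Γ] (g : Γ) : ℤˣ :=
  if ∃ m, Odd m ∧ g ^ m = 1 then 1 else -1

section OddOrderSign

variable {Γ : Type*} [Group Γ]

theorem oddOrderSign_eq_one {g : Γ} {m : ℕ} (hm : Odd m) (h : g ^ m = 1) : oddOrderSign g = 1 :=
  if_pos ⟨m, hm, h⟩

theorem pow_odd_eq_self {z : Γ} (hz : z * z = 1) {m : ℕ} (hm : Odd m) : z ^ m = z := by
  obtain ⟨k, rfl⟩ := hm
  rw [pow_succ, pow_mul, pow_two, hz, one_pow, one_mul]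

theorem oddOrderSign_eq_neg_one {z : Γ} (hz : z * z = 1) (hz1 : z ≠ 1) {g : Γ} {m : ℕ}
    (h : g ^ m = z) : oddOrderSign g = -1 := by
  refine if_neg ?_
  rintro ⟨k, hk, h1⟩
  apply hz1
  rw [← pow_odd_eq_self hz hk, ← h, ← pow_mul, mul_comm, pow_mul, h1, one_pow]

open Classical in
theorem oddOrderSign_conj (g h : Γ) : oddOrderSign (h * g * h⁻¹) = oddOrderSign g := by
  have h : (∃ m, Odd m ∧ (h * g * h⁻¹) ^ m = 1) ↔ ∃ m, Odd m ∧ g ^ m = 1 := by simp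
  unfold oddOrderSign
  exact if_congr h rfl rfl

open Classical in
theorem oddOrderSign_map {Δ : Type*} [Group Δ] (f : Γ →* Δ) (hf : Function.Injective f) (g : Γ) :
    oddOrderSign (f g) = oddOrderSign g := by
  have h : (∃ m, Odd m ∧ f g ^ m = 1) ↔ ∃ m, Odd m ∧ g ^ m = 1 := by
    simp only [← map_pow, map_eq_one_iff f hf]
  unfold oddOrderSign
  exact if_congr h rfl rfl

/-- Raising to an odd power fixes both 1 and `z`, so the odd power of `g` lying in `{1, z}` keeps
its value. -/
theorem oddOrderSign_pow {z : Γ} (hz : z * z = 1) (hz1 : z ≠ 1) {g : Γ}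
    (hg : ∃ m, Odd m ∧ (g ^ m = 1 ∨ g ^ m = z)) {k : ℕ} (hk : Odd k) :
    oddOrderSign (g ^ k) = oddOrderSign g := by
  obtain ⟨m, hm, h | h⟩ := hg
  · rw [oddOrderSign_eq_one hm h, oddOrderSign_eq_one hm (g := g ^ k)]
    rw [← pow_mul, mul_comm, pow_mul, h, one_pow]
  · rw [oddOrderSign_eq_neg_one hz hz1 h, oddOrderSign_eq_neg_one hz hz1 (g := g ^ k)]
    rw [← pow_mul, mul_comm, pow_mul, h, pow_odd_eq_self hz hk]

theorem Commute.oddOrderSign_mul {z : Γ} (hz : z * z = 1) (hz1 : z ≠ 1) {a b : Γ}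
    (hab : Commute a b) (ha : ∃ m, Odd m ∧ (a ^ m = 1 ∨ a ^ m = z))
    (hb : ∃ m, Odd m ∧ (b ^ m = 1 ∨ b ^ m = z)) :
    oddOrderSign (a * b) = oddOrderSign a * oddOrderSign b := by
  obtain ⟨m, hm, ha⟩ := ha
  obtain ⟨k, hk, hb⟩ := hb
  have hmk := hm.mul hk
  have key : (a * b) ^ (m * k) = (a ^ m) ^ k * (b ^ k) ^ m := by
    rw [hab.mul_pow, pow_mul, mul_comm m k, pow_mul b]
  rcases ha with ha | ha <;> rcases hb with hb | hb <;> rw [ha, hb] at key <;>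
    simp only [one_pow, pow_odd_eq_self hz hm, pow_odd_eq_self hz hk, one_mul, mul_one, hz] at key
  · rw [oddOrderSign_eq_one hmk key, oddOrderSign_eq_one hm ha, oddOrderSign_eq_one hk hb, one_mul]
  · rw [oddOrderSign_eq_neg_one hz hz1 key, oddOrderSign_eq_one hm ha,
      oddOrderSign_eq_neg_one hz hz1 hb, one_mul]
  · rw [oddOrderSign_eq_neg_one hz hz1 key, oddOrderSign_eq_neg_one hz hz1 ha,
      oddOrderSign_eq_one hk hb, mul_one]
  · rw [oddOrderSign_eq_one hmk key, oddOrderSign_eq_neg_one hz hz1 ha,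
      oddOrderSign_eq_neg_one hz hz1 hb]
    rfl

/-- In a finite group all of whose elements have an odd power in `{1, z}`, for a central
involution `z`, the sign is multiplicative. -/
theorem oddOrderSign_mul [Finite Γ] {z : Γ} (hzc : z ∈ Subgroup.center Γ) (hz : z * z = 1)
    (hz1 : z ≠ 1) (hodd : ∀ g : Γ, ∃ m, Odd m ∧ (g ^ m = 1 ∨ g ^ m = z)) (a b : Γ) :
    oddOrderSign (a * b) = oddOrderSign a * oddOrderSign b := by
  -- Otherwise Cauchy gives an element of order 2 modulo the centre, whereas an odd power of any
  -- element is central.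
  have hindex : Odd (Subgroup.center Γ).index := by
    rw [← Nat.not_even_iff_odd, even_iff_two_dvd, Subgroup.index]
    intro h
    obtain ⟨x, hx⟩ := exists_prime_orderOf_dvd_card' (G := Γ ⧸ Subgroup.center Γ) 2 h
    obtain ⟨g, rfl⟩ := QuotientGroup.mk_surjective x
    obtain ⟨m, hm, hg⟩ := hodd g
    have hgm : (g : Γ ⧸ Subgroup.center Γ) ^ m = 1 := by
      rw [← QuotientGroup.mk_pow, QuotientGroup.eq_one_iff]
      rcases hg with hg | hg <;> rw [hg]
      · exact one_mem _
      · exact hzc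
    have := orderOf_dvd_of_pow_eq_one hgm
    rw [hx] at this
    exact (Nat.not_even_iff_odd.mpr hm) (even_iff_two_dvd.mpr this)
  -- The transfer to the centre is the power map by the index, so this power map is a homomorphism
  -- with central values. Since the index is odd, it preserves signs and reduces the claim to
  -- commuting elements.
  have hpow : ∀ x y : Γ, (x * y) ^ (Subgroup.center Γ).index =
      x ^ (Subgroup.center Γ).index * y ^ (Subgroup.center Γ).index := fun x y => by
    have := congrArg Subtype.val (map_mul (MonoidHom.transferCenterPow Γ) x y)
    simpa only [MonoidHom.transferCenterPow_apply, Subgroup.coe_mul] using this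
  have hcenter : a ^ (Subgroup.center Γ).index ∈ Subgroup.center Γ := by
    rw [← MonoidHom.transferCenterPow_apply]
    exact Subtype.property _
  rw [← oddOrderSign_pow hz hz1 (hodd (a * b)) hindex, hpow,
    Commute.oddOrderSign_mul hz hz1 ((Subgroup.mem_center_iff.mp hcenter _).symm) (hodd _) (hodd _),
    oddOrderSign_pow hz hz1 (hodd a) hindex, oddOrderSign_pow hz hz1 (hodd b) hindex]

end OddOrderSign

/-! ### Lattices in K² and their normal form. -/

section Lattices

variable (O : Type*) {K : Type*} [CommRing O] [Field K] [Algebra O K]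

/-- The `O`-lattice in `K²` spanned by the columns of a matrix. -/
def columnLattice (g : Matrix (Fin 2) (Fin 2) K) : Submodule O (Fin 2 → K) :=
  LinearMap.range (((Matrix.toLin' g).restrictScalars O).comp
    ((Algebra.linearMap O K).compLeft (Fin 2)))

variable {O}

theorem mem_columnLattice {g : Matrix (Fin 2) (Fin 2) K} {x : Fin 2 → K} :
    x ∈ columnLattice O g ↔ ∃ y : Fin 2 → O, ∀ j,
      g j 0 * algebraMap O K (y 0) + g j 1 * algebraMap O K (y 1) = x j := by
  simp only [columnLattice, LinearMap.mem_range, funext_iff]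
  simp [Matrix.mulVec, dotProduct, Fin.sum_univ_two]

/-- The vertices of the tree of `SL(2, K)`: lattices together with the valuation `i ∈ {0, 1}` of
their covolume. -/
def IsLatticeOfType (ϖ : O) (i : ℕ) (L : Submodule O (Fin 2 → K)) : Prop :=
  ∃ g : Matrix (Fin 2) (Fin 2) K, g.det = algebraMap O K ϖ ^ i ∧ L = columnLattice O g

/-- The lattice `L` is `ϖ ^ (-n) • (O c + ϖ ^ (2n + i) O²)` for a vector `c` having a coordinate
equal to `1`. -/
def HasNormalForm (ϖ : O) (i n : ℕ) (c : Fin 2 → O) (L : Submodule O (Fin 2 → K)) : Prop :=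
  (∃ k, c k = 1) ∧ ∀ x, x ∈ L ↔ ∃ (α : O) (y : Fin 2 → O), ∀ j,
    algebraMap O K ϖ ^ n * x j = algebraMap O K (α * c j + ϖ ^ (2 * n + i) * y j)

/-- Column reduction with the unit `p` as pivot: the first column becomes `(1, r * p')` and the
second a unit multiple of `(0, h)`. The sign `ε` absorbs row and column swaps. -/
theorem span_eq_of_isUnit {p q r s p' ε h : O} (hp : p' * p = 1) (hε : ε * ε = 1)
    (hdet : p * s - q * r = ε * h) (a b : O) :
    (∃ z z', p * z + q * z' = a ∧ r * z + s * z' = b) ↔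
      ∃ α y y', a = α * 1 + h * y ∧ b = α * (r * p') + h * y' := by
  constructor
  · rintro ⟨z, z', rfl, rfl⟩
    refine ⟨p * z + q * z', 0, ε * z' * p', by ring, ?_⟩
    linear_combination (-r * z - s * z') * hp + p' * z' * hdet
  · rintro ⟨α, y, y', rfl, rfl⟩
    refine ⟨p' * (α + h * y - q * (ε * p * (y' - r * p' * y))), ε * p * (y' - r * p' * y), ?_, ?_⟩
    · linear_combination (α + h * y - q * (ε * p * (y' - r * p' * y))) * hp
    · linear_combination (ε * (y' - r * p' * y)) * hdet + h * (y' - r * p' * y) * hε -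
        r * q * ε * (y' - r * p' * y) * hp

variable [IsFractionRing O K]

theorem hasNormalForm_of_isUnit {ϖ : O} (hϖ : ϖ ≠ 0) {i n : ℕ} {g : Matrix (Fin 2) (Fin 2) K}
    {A : Matrix (Fin 2) (Fin 2) O} (hA : ∀ k l, algebraMap O K (A k l) = algebraMap O K ϖ ^ n * g k l)
    (hdet : A.det = ϖ ^ (2 * n + i)) {k l : Fin 2} (hu : IsUnit (A k l)) :
    ∃ c, HasNormalForm ϖ i n c (columnLattice O g) := by
  have hinj : Function.Injective (algebraMap O K) := IsFractionRing.injective O K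
  have hw : algebraMap O K ϖ ^ n ≠ 0 := pow_ne_zero _ ((map_ne_zero_iff _ hinj).mpr hϖ)
  obtain ⟨p', hp'⟩ := hu.exists_left_inv
  rw [Matrix.det_fin_two] at hdet
  have hmem : ∀ x, x ∈ columnLattice O g ↔ ∃ y : Fin 2 → O, ∀ j,
      algebraMap O K ϖ ^ n * x j = algebraMap O K (A j 0 * y 0 + A j 1 * y 1) := by
    intro x
    rw [mem_columnLattice]
    refine exists_congr fun y => forall_congr' fun j => ?_
    rw [map_add, map_mul, map_mul, hA, hA, mul_assoc, mul_assoc, ← mul_add, mul_right_inj' hw,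
      eq_comm]
  have hodd : ∀ x : Fin 2 → K, (∃ y : Fin 2 → O, ∀ j,
      algebraMap O K ϖ ^ n * x j = algebraMap O K (A j 0 * y 0 + A j 1 * y 1)) ↔
      ∃ a : Fin 2 → O, (∀ j, algebraMap O K ϖ ^ n * x j = algebraMap O K (a j)) ∧
        ∃ y : Fin 2 → O, ∀ j, A j 0 * y 0 + A j 1 * y 1 = a j :=
    fun x => ⟨fun ⟨y, hy⟩ => ⟨_, hy, y, fun j => rfl⟩,
      fun ⟨a, ha, y, hy⟩ => ⟨y, fun j => by rw [ha, hy]⟩⟩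
  have hcol : ∀ (c : Fin 2 → O) (x : Fin 2 → K), (∃ (α : O) (y : Fin 2 → O), ∀ j,
      algebraMap O K ϖ ^ n * x j = algebraMap O K (α * c j + ϖ ^ (2 * n + i) * y j)) ↔
      ∃ a : Fin 2 → O, (∀ j, algebraMap O K ϖ ^ n * x j = algebraMap O K (a j)) ∧
        ∃ (α : O) (y : Fin 2 → O), ∀ j, a j = α * c j + ϖ ^ (2 * n + i) * y j :=
    fun c x => ⟨fun ⟨α, y, hy⟩ => ⟨_, hy, α, y, fun j => rfl⟩,
      fun ⟨a, ha, α, y, hy⟩ => ⟨α, y, fun j => by rw [ha, hy]⟩⟩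
  have hpair : ∀ P : O → O → Prop, (∃ y : Fin 2 → O, P (y 0) (y 1)) ↔ ∃ z z', P z z' :=
    fun P => ⟨fun ⟨y, hy⟩ => ⟨_, _, hy⟩, fun ⟨z, z', h⟩ => ⟨![z, z'], h⟩⟩
  have hswap : ∀ P : O → O → Prop, (∃ z z', P z z') ↔ ∃ z z', P z' z :=
    fun P => exists_comm
  refine ⟨fun j => A j l * p', ⟨k, (mul_comm _ _).trans hp'⟩, fun x => ?_⟩
  rw [hmem, hodd, hcol]
  refine exists_congr fun a => and_congr_right fun _ => ?_
  simp only [Fin.forall_fin_two]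
  rw [hpair fun z z' => A 0 0 * z + A 0 1 * z' = a 0 ∧ A 1 0 * z + A 1 1 * z' = a 1]
  have hp1 : A k l * p' = 1 := by rw [mul_comm]; exact hp'
  have hr : (∃ (α : O) (y : Fin 2 → O), a 0 = α * (A 0 l * p') + ϖ ^ (2 * n + i) * y 0 ∧
      a 1 = α * (A 1 l * p') + ϖ ^ (2 * n + i) * y 1) ↔
      ∃ α z z', a 0 = α * (A 0 l * p') + ϖ ^ (2 * n + i) * z ∧
      a 1 = α * (A 1 l * p') + ϖ ^ (2 * n + i) * z' :=
    exists_congr fun α => hpair fun z z' => a 0 = α * (A 0 l * p') + ϖ ^ (2 * n + i) * z ∧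
      a 1 = α * (A 1 l * p') + ϖ ^ (2 * n + i) * z'
  rw [hr]
  have hneg : (-1 : O) * -1 = 1 := by ring
  have e1 : (1 : O) * 1 = 1 := by ring
  -- Swapping rows or columns moves the unit entry to the top left; each swap changes the sign of
  -- the determinant.
  fin_cases k <;> fin_cases l <;> simp only [Fin.zero_eta, Fin.mk_one] at hp' hp1 ⊢ <;>
    simp only [hp1]
  · exact span_eq_of_isUnit hp' e1 (by linear_combination hdet) _ _
  · have key := span_eq_of_isUnit (q := A 0 0) (r := A 1 1) (s := A 1 0) (h := ϖ ^ (2 * n + i)) hp'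
      hneg (by linear_combination -hdet) (a 0) (a 1)
    simp only [add_comm (A 0 1 * _), add_comm (A 1 1 * _)] at key
    rw [hswap, key]
  · have key := span_eq_of_isUnit (q := A 1 1) (r := A 0 0) (s := A 0 1) (h := ϖ ^ (2 * n + i)) hp'
      hneg (by linear_combination -hdet) (a 1) (a 0)
    simp only [and_comm (a := A 0 0 * _ + _ = _), key]
    exact exists_congr fun α => exists_comm.trans
      (exists_congr fun z => exists_congr fun z' => and_comm)
  · have key := span_eq_of_isUnit (q := A 1 0) (r := A 0 1) (s := A 0 0) (h := ϖ ^ (2 * n + i)) hp'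
      e1 (by linear_combination hdet) (a 1) (a 0)
    simp only [add_comm (A 0 1 * _), add_comm (A 1 1 * _)] at key
    rw [hswap]
    simp only [and_comm (a := A 0 0 * _ + _ = _), key]
    exact exists_congr fun α => exists_comm.trans
      (exists_congr fun z => exists_congr fun z' => and_comm)

end Lattices

/-! ### Levels of lattices and the neighbour relation. -/

section Lattices

variable {O K : Type*} [CommRing O] [Field K] [Algebra O K]

theorem HasNormalForm.exists_integral {ϖ : O} {i n : ℕ} {c : Fin 2 → O}
    {L : Submodule O (Fin 2 → K)} (h : HasNormalForm ϖ i n c L) {x : Fin 2 → K} (hx : x ∈ L) :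
    ∃ y : Fin 2 → O, ∀ j, algebraMap O K ϖ ^ n * x j = algebraMap O K (y j) := by
  obtain ⟨α, y, hy⟩ := (h.2 x).mp hx
  exact ⟨_, hy⟩

theorem HasNormalForm.pow_smul_mem {ϖ : O} {i n : ℕ} {c : Fin 2 → O}
    {L : Submodule O (Fin 2 → K)} (h : HasNormalForm ϖ i n c L) {m : ℕ} (hm : n + i ≤ m)
    (y : Fin 2 → O) : (fun j => algebraMap O K (ϖ ^ m * y j)) ∈ L := by
  obtain ⟨k, rfl⟩ := Nat.exists_eq_add_of_le hm
  refine (h.2 _).mpr ⟨0, fun j => ϖ ^ k * y j, fun j => ?_⟩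
  rw [← map_pow, ← map_mul]
  congr 1
  ring

/-- Both lattices are O² itself, which is the root of the tree. -/
theorem HasNormalForm.eq_of_level_zero {ϖ : O} {c c' : Fin 2 → O}
    {L L' : Submodule O (Fin 2 → K)} (h : HasNormalForm ϖ 0 0 c L) (h' : HasNormalForm ϖ 0 0 c' L') :
    L = L' := by
  have key : ∀ {c : Fin 2 → O} {L : Submodule O (Fin 2 → K)}, HasNormalForm ϖ 0 0 c L → ∀ x,
      x ∈ L ↔ ∃ y : Fin 2 → O, ∀ j, x j = algebraMap O K (y j) := by
    intro c L h x
    rw [h.2]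
    constructor
    · rintro ⟨α, y, hy⟩
      exact ⟨fun j => α * c j + y j, fun j => by simpa using hy j⟩
    · rintro ⟨y, hy⟩
      exact ⟨0, y, fun j => by simpa using hy j⟩
  ext x
  rw [key h, key h']

variable [IsFractionRing O K]

/-- The vector `c` with a coordinate 1 completes to an integral matrix of determinant `ϖ ^ (2 * n +
i)`. This makes the neighbours constructed by normal forms into vertices. -/
theorem HasNormalForm.isLatticeOfType {ϖ : O} (hϖ : ϖ ≠ 0) {i n : ℕ} {c : Fin 2 → O}
    {L : Submodule O (Fin 2 → K)} (h : HasNormalForm ϖ i n c L) : IsLatticeOfType ϖ i L := by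
  have hinj : Function.Injective (algebraMap O K) := IsFractionRing.injective O K
  have hw : algebraMap O K ϖ ≠ 0 := (map_ne_zero_iff _ hinj).mpr hϖ
  have hw' : algebraMap O K ϖ ^ n ≠ 0 := pow_ne_zero _ hw
  obtain ⟨⟨k, hk⟩, hL⟩ := h
  have build : ∀ A : Matrix (Fin 2) (Fin 2) O, A.det = ϖ ^ (2 * n + i) →
      (∀ a : Fin 2 → O, (∃ y : Fin 2 → O, ∀ j, A j 0 * y 0 + A j 1 * y 1 = a j) ↔
        ∃ (α : O) (y : Fin 2 → O), ∀ j, a j = α * c j + ϖ ^ (2 * n + i) * y j) →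
      IsLatticeOfType ϖ i L := by
    intro A hA hAc
    refine ⟨Matrix.of fun j l => (algebraMap O K ϖ ^ n)⁻¹ * algebraMap O K (A j l), ?_, ?_⟩
    · have h1 := congrArg (algebraMap O K) hA
      rw [Matrix.det_fin_two, map_sub, map_mul, map_mul, map_pow, pow_add, pow_mul'] at h1
      rw [Matrix.det_fin_two]
      simp only [Matrix.of_apply]
      field_simp
      linear_combination h1
    · ext x
      rw [hL, mem_columnLattice]
      simp only [Matrix.of_apply]
      have hx : ∀ y : Fin 2 → O, (∀ j, (algebraMap O K ϖ ^ n)⁻¹ * algebraMap O K (A j 0) *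
          algebraMap O K (y 0) + (algebraMap O K ϖ ^ n)⁻¹ * algebraMap O K (A j 1) *
          algebraMap O K (y 1) = x j) ↔
          ∀ j, algebraMap O K ϖ ^ n * x j = algebraMap O K (A j 0 * y 0 + A j 1 * y 1) := by
        refine fun y => forall_congr' fun j => ?_
        rw [mul_assoc, mul_assoc, ← mul_add, inv_mul_eq_iff_eq_mul₀ hw', map_add, map_mul, map_mul,
          eq_comm]
      constructor
      · rintro ⟨α, y, hy⟩
        obtain ⟨y', hy'⟩ := (hAc fun j => α * c j + ϖ ^ (2 * n + i) * y j).mpr ⟨α, y, fun j => rfl⟩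
        exact ⟨y', (hx y').mpr fun j => by rw [hy, hy']⟩
      · rintro ⟨y', hy'⟩
        obtain ⟨α, y, hy⟩ := (hAc fun j => A j 0 * y' 0 + A j 1 * y' 1).mp ⟨y', fun j => rfl⟩
        exact ⟨α, y, fun j => by rw [(hx y').mp hy', hy]⟩
  fin_cases k
  · replace hk : c 0 = 1 := hk
    refine build !![1, 0; c 1, ϖ ^ (2 * n + i)] (by simp [Matrix.det_fin_two]) fun a => ?_
    simp only [Fin.forall_fin_two, hk]
    constructor
    · rintro ⟨y, h0, h1⟩
      refine ⟨y 0, ![0, y 1], ?_, ?_⟩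
      · simp at h0 ⊢; exact h0.symm
      · simp at h1 ⊢; linear_combination -h1
    · rintro ⟨α, y, h0, h1⟩
      refine ⟨![α + ϖ ^ (2 * n + i) * y 0, y 1 - c 1 * y 0], ?_, ?_⟩
      · simp [h0]
      · simp [h1]; ring
  · replace hk : c 1 = 1 := hk
    refine build !![c 0, -ϖ ^ (2 * n + i); 1, 0] (by simp [Matrix.det_fin_two]) fun a => ?_
    simp only [Fin.forall_fin_two, hk]
    constructor
    · rintro ⟨y, h0, h1⟩
      refine ⟨y 0, ![-y 1, 0], ?_, ?_⟩
      · simp at h0 ⊢; linear_combination -h0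
      · simp at h1 ⊢; exact h1.symm
    · rintro ⟨α, y, h0, h1⟩
      refine ⟨![α + ϖ ^ (2 * n + i) * y 1, -(y 0 - c 0 * y 1)], ?_, ?_⟩
      · simp [h0]; ring
      · simp [h1]

theorem HasNormalForm.exists_mem {ϖ : O} (hϖ : ϖ ≠ 0) {i n : ℕ} {c : Fin 2 → O}
    {L : Submodule O (Fin 2 → K)} (h : HasNormalForm ϖ i n c L) :
    ∃ x ∈ L, ∀ j, algebraMap O K ϖ ^ n * x j = algebraMap O K (c j) := by
  have hinj : Function.Injective (algebraMap O K) := IsFractionRing.injective O K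
  have hw : algebraMap O K ϖ ^ n ≠ 0 := pow_ne_zero _ ((map_ne_zero_iff _ hinj).mpr hϖ)
  have : ∀ j, algebraMap O K ϖ ^ n * ((algebraMap O K ϖ ^ n)⁻¹ * algebraMap O K (c j)) =
    algebraMap O K (c j) := fun j => by rw [mul_inv_cancel_left₀ hw]
  refine ⟨fun j => (algebraMap O K ϖ ^ n)⁻¹ * algebraMap O K (c j), (h.2 _).mpr ⟨1, 0, fun j => ?_⟩,
    this⟩
  simp [this]

variable [IsDomain O]

/-- The vector `ϖ ^ (-n) • c` lies in `L` and has a coordinate `ϖ ^ (-n)`. So the level is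
intrinsic: the least power of `ϖ` carrying `L` into O². -/
theorem HasNormalForm.level_le {ϖ : O} (hϖ : Irreducible ϖ) {i n m : ℕ} {c : Fin 2 → O}
    {L : Submodule O (Fin 2 → K)} (h : HasNormalForm ϖ i n c L)
    (hm : ∀ x ∈ L, ∃ y : Fin 2 → O, ∀ j, algebraMap O K ϖ ^ m * x j = algebraMap O K (y j)) :
    n ≤ m := by
  have hinj : Function.Injective (algebraMap O K) := IsFractionRing.injective O K
  obtain ⟨x, hx, hxc⟩ := h.exists_mem hϖ.ne_zero
  obtain ⟨k, hk⟩ := h.1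
  obtain ⟨y, hy⟩ := hm x hx
  have h1 : ϖ ^ m * c k = ϖ ^ n * y k := by
    apply hinj
    rw [map_mul, map_mul, map_pow, map_pow, ← hxc, ← hy]
    ring
  rw [hk, mul_one] at h1
  exact (pow_dvd_pow_iff hϖ.ne_zero hϖ.not_isUnit).mp ⟨_, h1⟩

theorem HasNormalForm.level_unique {ϖ : O} (hϖ : Irreducible ϖ) {i i' n n' : ℕ} {c c' : Fin 2 → O}
    {L : Submodule O (Fin 2 → K)} (h : HasNormalForm ϖ i n c L) (h' : HasNormalForm ϖ i' n' c' L) :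
    n = n' :=
  le_antisymm (h.level_le hϖ fun _ => h'.exists_integral) (h'.level_le hϖ fun _ => h.exists_integral)

theorem HasNormalForm.exists_pow_smul_notMem {ϖ : O} (hϖ : Irreducible ϖ) {n : ℕ} {c : Fin 2 → O}
    {L : Submodule O (Fin 2 → K)} (h : HasNormalForm ϖ 1 n c L) :
    ∃ y : Fin 2 → O, (fun j => algebraMap O K (ϖ ^ n * y j)) ∉ L := by
  have hinj : Function.Injective (algebraMap O K) := IsFractionRing.injective O K
  obtain ⟨k, hk⟩ := h.1
  -- The basis vector complementary to the coordinate where `c` is 1: eliminating `α` would give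
  -- that `ϖ ^ (2 * n + 1)` divides `ϖ ^ (2 * n)`.
  refine ⟨Pi.single (1 - k) 1, fun hmem => ?_⟩
  obtain ⟨α, y, hy⟩ := (h.2 _).mp hmem
  have hy' : ∀ j, ϖ ^ n * (ϖ ^ n * (Pi.single (1 - k) 1 : Fin 2 → O) j) =
      α * c j + ϖ ^ (2 * n + 1) * y j := fun j => by
    apply hinj
    rw [← hy, map_mul, map_pow]
  have h1 := hy' k
  have h2 := hy' (1 - k)
  rw [hk, Pi.single_eq_of_ne (by fin_cases k <;> decide)] at h1
  rw [Pi.single_eq_same] at h2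
  have h3 : ϖ ^ (2 * n) = ϖ ^ (2 * n + 1) * (y (1 - k) - y k * c (1 - k)) := by
    linear_combination h2 - c (1 - k) * h1
  have := (pow_dvd_pow_iff hϖ.ne_zero hϖ.not_isUnit).mp ⟨_, h3⟩
  omega

/-- The sum `M ⊔ M'` still has smaller level than `L`, so it is proper in `L`; by maximality both
lattices equal it. -/
theorem lower_neighbour_unique {ϖ : O} (hϖ : Irreducible ϖ) {n : ℕ} {c : Fin 2 → O}
    {L M M' : Submodule O (Fin 2 → K)} (h : HasNormalForm ϖ 0 n c L)
    {m m' : ℕ} {d d' : Fin 2 → O} (hM : HasNormalForm ϖ 1 m d M) (hM' : HasNormalForm ϖ 1 m' d' M')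
    (hML : M ⋖ L) (hML' : M' ⋖ L) (hm : m < n) (hm' : m' < n) : M = M' := by
  -- The level of `L` is now `0 + n + 1`, and `0 + n` bounds the levels of `M` and `M'`.
  obtain ⟨n, rfl⟩ := Nat.exists_eq_add_of_lt (Nat.zero_le m |>.trans_lt hm)
  have hint : ∀ {m : ℕ} {d : Fin 2 → O} {M : Submodule O (Fin 2 → K)}, HasNormalForm ϖ 1 m d M →
      m ≤ 0 + n → ∀ x ∈ M, ∃ y : Fin 2 → O, ∀ j,
        algebraMap O K ϖ ^ (0 + n) * x j = algebraMap O K (y j) := by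
    intro m d M hM hm x hx
    obtain ⟨y, hy⟩ := hM.exists_integral hx
    obtain ⟨k, hk⟩ := Nat.exists_eq_add_of_le hm
    exact ⟨fun j => ϖ ^ k * y j, fun j => by
      rw [hk, add_comm, pow_add, mul_assoc, hy, map_mul, map_pow]⟩
  have hlt : M ⊔ M' < L := by
    refine lt_of_le_of_ne (sup_le hML.le hML'.le) fun heq => ?_
    have := h.level_le hϖ (m := 0 + n) fun x hx => by
      rw [← heq] at hx
      obtain ⟨a, ha, b, hb, rfl⟩ := Submodule.mem_sup.mp hx
      obtain ⟨y, hy⟩ := hint hM (by omega) a ha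
      obtain ⟨z, hz⟩ := hint hM' (by omega) b hb
      exact ⟨y + z, fun j => by rw [Pi.add_apply, mul_add, hy, hz, Pi.add_apply, map_add]⟩
    omega
  have h1 : M = M ⊔ M' := ((hML.eq_or_eq le_sup_left hlt.le).resolve_right hlt.ne).symm
  have h2 : M' = M ⊔ M' := ((hML'.eq_or_eq le_sup_right hlt.le).resolve_right hlt.ne).symm
  exact h1.trans h2.symm

/-- Dually, `L ⊓ L'` contains `ϖ ^ n` O² while `M` does not, so the intersection is strictly larger
than `M` and equals both lattices. -/
theorem lower_neighbour_unique_of_type_one {ϖ : O} (hϖ : Irreducible ϖ) {n : ℕ} {c : Fin 2 → O}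
    {M L L' : Submodule O (Fin 2 → K)} (h : HasNormalForm ϖ 1 n c M)
    {m m' : ℕ} {d d' : Fin 2 → O} (hL : HasNormalForm ϖ 0 m d L) (hL' : HasNormalForm ϖ 0 m' d' L')
    (hML : M ⋖ L) (hML' : M ⋖ L') (hm : m ≤ n) (hm' : m' ≤ n) : L = L' := by
  obtain ⟨y, hy⟩ := h.exists_pow_smul_notMem hϖ
  have hlt : M < L ⊓ L' := by
    refine lt_of_le_of_ne (le_inf hML.le hML'.le) fun heq => hy ?_
    rw [heq]
    exact ⟨hL.pow_smul_mem (by omega) y, hL'.pow_smul_mem (by omega) y⟩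
  have h1 : L ⊓ L' = L := (hML.eq_or_eq hlt.le inf_le_left).resolve_left hlt.ne'
  have h2 : L ⊓ L' = L' := (hML'.eq_or_eq hlt.le inf_le_right).resolve_left hlt.ne'
  exact h1.symm.trans h2

variable [IsDiscreteValuationRing O]

theorem exists_pow_mul_eq_algebraMap {ϖ : O} (hϖ : Irreducible ϖ) (x : K) :
    ∃ (n : ℕ) (a : O), algebraMap O K a = algebraMap O K ϖ ^ n * x := by
  obtain ⟨a, b, hb, rfl⟩ := IsFractionRing.div_surjective (A := O) x
  obtain ⟨n, u, rfl⟩ := IsDiscreteValuationRing.eq_unit_mul_pow_irreducible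
    (nonZeroDivisors.ne_zero hb) hϖ
  have hw : algebraMap O K ϖ ≠ 0 :=
    (map_ne_zero_iff _ (IsFractionRing.injective O K)).mpr hϖ.ne_zero
  have hu : algebraMap O K ↑u ≠ 0 := (u.isUnit.map (algebraMap O K)).ne_zero
  refine ⟨n, ↑u⁻¹ * a, ?_⟩
  have h1 : algebraMap O K ↑u * algebraMap O K ↑u⁻¹ = 1 := by
    rw [← map_mul, Units.mul_inv, map_one]
  rw [map_mul, map_mul, map_pow]
  field_simp
  linear_combination algebraMap O K a * h1

theorem dvd_of_not_isUnit {ϖ : O} (hϖ : Irreducible ϖ) {a : O} (ha : ¬ IsUnit a) : ϖ ∣ a := by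
  rw [← Ideal.mem_span_singleton, ← hϖ.maximalIdeal_eq]
  exact ha

/-- For the least `n` making `ϖ ^ n • g` integral, some entry is a unit. Otherwise all entries are
divisible by `ϖ`: either `n` can be lowered, or `n = 0` and `ϖ ^ 2` divides `ϖ ^ i` with `i ≤ 1`. -/
theorem IsLatticeOfType.exists_hasNormalForm {ϖ : O} (hϖ : Irreducible ϖ) {i : ℕ} (hi : i ≤ 1)
    {L : Submodule O (Fin 2 → K)} (h : IsLatticeOfType ϖ i L) :
    ∃ n c, HasNormalForm ϖ i n c L := by
  obtain ⟨g, hg, rfl⟩ := h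
  have hinj : Function.Injective (algebraMap O K) := IsFractionRing.injective O K
  have hw : algebraMap O K ϖ ≠ 0 := (map_ne_zero_iff _ hinj).mpr hϖ.ne_zero
  have hex : ∃ n : ℕ, ∀ k l, ∃ a : O, algebraMap O K a = algebraMap O K ϖ ^ n * g k l := by
    choose m a hm using fun k l => exists_pow_mul_eq_algebraMap (K := K) hϖ (g k l)
    refine ⟨∑ k, ∑ l, m k l, fun k l => ?_⟩
    have hle : m k l ≤ ∑ k, ∑ l, m k l :=
      (Finset.single_le_sum (f := fun l => m k l) (fun _ _ => zero_le) (Finset.mem_univ l)).trans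
        (Finset.single_le_sum (f := fun k => ∑ l, m k l) (fun _ _ => zero_le)
          (Finset.mem_univ k))
    obtain ⟨d, hd⟩ := Nat.exists_eq_add_of_le hle
    refine ⟨ϖ ^ d * a k l, ?_⟩
    rw [map_mul, map_pow, hm, hd, pow_add]
    ring
  classical
  obtain ⟨n, hn, hmin⟩ : ∃ n : ℕ, (∀ k l, ∃ a : O, algebraMap O K a = algebraMap O K ϖ ^ n * g k l) ∧
      ∀ m < n, ¬ ∀ k l, ∃ a : O, algebraMap O K a = algebraMap O K ϖ ^ m * g k l :=
    ⟨Nat.find hex, Nat.find_spec hex, fun m hm => Nat.find_min hex hm⟩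
  obtain ⟨A, hA⟩ : ∃ A : Matrix (Fin 2) (Fin 2) O,
      ∀ k l, algebraMap O K (A k l) = algebraMap O K ϖ ^ n * g k l := by
    choose A hA using hn
    exact ⟨Matrix.of A, hA⟩
  have hdet : A.det = ϖ ^ (2 * n + i) := by
    apply hinj
    rw [Matrix.det_fin_two, map_sub, map_mul, map_mul, hA, hA, hA, hA, map_pow, pow_add, ← hg,
      Matrix.det_fin_two]
    ring
  suffices hunit : ∃ k l, IsUnit (A k l) by
    obtain ⟨k, l, hu⟩ := hunit
    exact ⟨n, hasNormalForm_of_isUnit hϖ.ne_zero hA hdet hu⟩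
  by_contra! hno
  choose B hB using fun k l => dvd_of_not_isUnit hϖ (hno k l)
  rcases n with _ | n
  · have h1 : ϖ ^ 2 * (B 0 0 * B 1 1 - B 0 1 * B 1 0) = ϖ ^ i := by
      rw [Matrix.det_fin_two, hB, hB, hB, hB] at hdet
      rw [mul_zero, zero_add] at hdet
      linear_combination hdet
    have := (pow_dvd_pow_iff hϖ.ne_zero hϖ.not_isUnit).mp ⟨_, h1.symm⟩
    omega
  · refine hmin n (Nat.lt_succ_self n) fun k l => ⟨B k l, ?_⟩
    have h1 := hA k l
    rw [hB, map_mul, pow_succ', mul_assoc] at h1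
    exact mul_left_cancel₀ hw h1

/-- A lattice of type `0` other than the standard one covers a lattice of type `1` of lower level. -/
theorem HasNormalForm.exists_covBy {ϖ : O} (hϖ : Irreducible ϖ) {n : ℕ} {c : Fin 2 → O}
    {L : Submodule O (Fin 2 → K)} (h : HasNormalForm ϖ 0 (n + 1) c L) :
    ∃ M : Submodule O (Fin 2 → K), HasNormalForm ϖ 1 n c M ∧ M ⋖ L := by
  have hinj : Function.Injective (algebraMap O K) := IsFractionRing.injective O K
  have hw : algebraMap O K ϖ ≠ 0 := (map_ne_zero_iff _ hinj).mpr hϖ.ne_zero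
  let M : Submodule O (Fin 2 → K) :=
    { carrier := {x | ∃ (α : O) (y : Fin 2 → O), ∀ j,
        algebraMap O K ϖ ^ n * x j = algebraMap O K (α * c j + ϖ ^ (2 * n + 1) * y j)}
      add_mem' := by
        rintro a b ⟨α, y, h1⟩ ⟨β, z, h2⟩
        refine ⟨α + β, y + z, fun j => ?_⟩
        rw [Pi.add_apply, mul_add, h1, h2, ← map_add, Pi.add_apply]
        congr 1
        ring
      zero_mem' := ⟨0, 0, fun j => by simp⟩
      smul_mem' := by
        rintro r a ⟨α, y, h1⟩
        refine ⟨r * α, r • y, fun j => ?_⟩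
        rw [Pi.smul_apply, Algebra.smul_def, mul_left_comm, h1, ← map_mul, Pi.smul_apply,
          smul_eq_mul]
        congr 1
        ring }
  have hM : HasNormalForm ϖ 1 n c M := ⟨h.1, fun x => Iff.rfl⟩
  have hmem : ∀ (x : Fin 2 → K) (α : O) (y : Fin 2 → O), (∀ j, algebraMap O K ϖ ^ (n + 1) * x j =
      algebraMap O K (ϖ * α * c j + ϖ ^ (2 * (n + 1) + 0) * y j)) → x ∈ M := by
    refine fun x α y hx => ⟨α, y, fun j => mul_left_cancel₀ hw ?_⟩
    rw [← mul_assoc, ← pow_succ', hx, ← map_mul]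
    congr 1
    ring
  refine ⟨M, hM, ⟨lt_of_le_of_ne ?_ ?_, ?_⟩⟩
  · rintro x ⟨α, y, hx⟩
    refine (h.2 x).mpr ⟨ϖ * α, y, fun j => ?_⟩
    rw [pow_succ', mul_assoc, hx, ← map_mul]
    congr 1
    ring
  · intro hML
    have := h.level_le hϖ (m := n) fun x hx => hM.exists_integral (hML ▸ hx)
    omega
  · intro N hMN hNL
    obtain ⟨x, hxN, hxM⟩ := SetLike.exists_of_lt hMN
    obtain ⟨α, y, hx⟩ := (h.2 x).mp (hNL.le hxN)
    -- `M` contains the vectors of `L` whose coefficient of `c` is divisible by `ϖ`; a vector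
    -- outside `M` therefore has a unit coefficient and generates `L` modulo `M`.
    have hα : IsUnit α := by
      by_contra hα
      obtain ⟨β, rfl⟩ := dvd_of_not_isUnit hϖ hα
      exact hxM (hmem x β y hx)
    obtain ⟨α', hα'⟩ := hα.exists_right_inv
    refine hNL.not_ge fun x' hx' => ?_
    obtain ⟨β, y', hx'⟩ := (h.2 x').mp hx'
    have hdiff : x' - (β * α') • x ∈ M := by
      refine hmem _ 0 (y' - (β * α') • y) fun j => ?_
      rw [Pi.sub_apply, Pi.smul_apply, Algebra.smul_def, mul_sub, mul_left_comm, hx, hx', ← map_mul,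
        ← map_sub, Pi.sub_apply, Pi.smul_apply, smul_eq_mul]
      congr 1
      linear_combination (-β * c j) * hα'
    simpa using N.add_mem (hMN.le hdiff) (N.smul_mem (β * α') hxN)

/-- A lattice of type `1` is covered by a lattice of type `0` of the same level. -/
theorem HasNormalForm.exists_covBy_of_type_one {ϖ : O} (hϖ : Irreducible ϖ) {n : ℕ} {c : Fin 2 → O}
    {M : Submodule O (Fin 2 → K)} (h : HasNormalForm ϖ 1 n c M) :
    ∃ L : Submodule O (Fin 2 → K), HasNormalForm ϖ 0 n c L ∧ M ⋖ L := by
  have hinj : Function.Injective (algebraMap O K) := IsFractionRing.injective O K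
  have hw : algebraMap O K ϖ ≠ 0 := (map_ne_zero_iff _ hinj).mpr hϖ.ne_zero
  let L : Submodule O (Fin 2 → K) :=
    { carrier := {x | ∃ (α : O) (y : Fin 2 → O), ∀ j,
        algebraMap O K ϖ ^ n * x j = algebraMap O K (α * c j + ϖ ^ (2 * n + 0) * y j)}
      add_mem' := by
        rintro a b ⟨α, y, h1⟩ ⟨β, z, h2⟩
        refine ⟨α + β, y + z, fun j => ?_⟩
        rw [Pi.add_apply, mul_add, h1, h2, ← map_add, Pi.add_apply]
        congr 1
        ring
      zero_mem' := ⟨0, 0, fun j => by simp⟩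
      smul_mem' := by
        rintro r a ⟨α, y, h1⟩
        refine ⟨r * α, r • y, fun j => ?_⟩
        rw [Pi.smul_apply, Algebra.smul_def, mul_left_comm, h1, ← map_mul, Pi.smul_apply,
          smul_eq_mul]
        congr 1
        ring }
  have hL : HasNormalForm ϖ 0 n c L := ⟨h.1, fun x => Iff.rfl⟩
  obtain ⟨k, hk⟩ := h.1
  -- reduce the second coefficient to the coordinate complementary to `k`
  have hred : ∀ x ∈ L, ∃ (α s : O), ∀ j, algebraMap O K ϖ ^ n * x j =
      algebraMap O K (α * c j + ϖ ^ (2 * n) * (s * (Pi.single (1 - k) 1 : Fin 2 → O) j)) := by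
    rintro x ⟨α, y, hx⟩
    refine ⟨α + ϖ ^ (2 * n) * y k, y (1 - k) - y k * c (1 - k), fun j => ?_⟩
    rw [hx]
    congr 1
    obtain rfl | rfl : j = k ∨ j = 1 - k := by fin_cases j <;> fin_cases k <;> decide
    · rw [hk, Pi.single_eq_of_ne (by fin_cases j <;> decide)]
      ring
    · rw [Pi.single_eq_same]
      ring
  refine ⟨L, hL, ⟨lt_of_le_of_ne ?_ ?_, ?_⟩⟩
  · intro x hx
    obtain ⟨α, y, hx⟩ := (h.2 x).mp hx
    refine ⟨α, ϖ • y, fun j => ?_⟩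
    rw [hx, Pi.smul_apply, smul_eq_mul]
    congr 1
    ring
  · intro hML
    obtain ⟨y, hy⟩ := h.exists_pow_smul_notMem hϖ
    exact hy (hML ▸ hL.pow_smul_mem le_rfl y)
  · intro N hMN hNL
    obtain ⟨x, hxN, hxM⟩ := SetLike.exists_of_lt hMN
    obtain ⟨α, s, hx⟩ := hred x (hNL.le hxN)
    -- Modulo `M`, the lattice `L` is generated by `ϖ ^ n` times the complementary basis vector, and
    -- `s` is the coefficient of it.
    have hs : IsUnit s := by
      by_contra hs
      obtain ⟨t, rfl⟩ := dvd_of_not_isUnit hϖ hs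
      refine hxM ((h.2 x).mpr ⟨α, t • Pi.single (1 - k) 1, fun j => ?_⟩)
      rw [hx, Pi.smul_apply, smul_eq_mul]
      congr 1
      ring
    obtain ⟨s', hs'⟩ := hs.exists_right_inv
    refine hNL.not_ge fun x' hx' => ?_
    obtain ⟨β, t, hx'⟩ := hred x' hx'
    have hdiff : x' - (t * s') • x ∈ M := by
      refine (h.2 _).mpr ⟨β - t * s' * α, 0, fun j => ?_⟩
      rw [Pi.sub_apply, Pi.smul_apply, Algebra.smul_def, mul_sub, mul_left_comm, hx, hx', ← map_mul,
        ← map_sub, Pi.zero_apply]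
      congr 1
      linear_combination (-t * ϖ ^ (2 * n) * (Pi.single (1 - k) 1 : Fin 2 → O) j) * hs'
    simpa using N.add_mem (hMN.le hdiff) (N.smul_mem (t * s') hxN)

end Lattices

/-! ### The action of SL₂(K) on the tree. -/

section Tree

variable (K : Type*) {O : Type*} [CommRing O] [Field K] [Algebra O K]

/-- The vertices of the Bruhat-Tits tree of `SL(2, K)`, as lattices of covolume `1` or `ϖ`. -/
def TreeVertex (ϖ : O) : Type _ :=
  {v : Submodule O (Fin 2 → K) × Fin 2 // IsLatticeOfType ϖ v.2 v.1}

variable {K}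

/-- The order automorphism of the lattice of `O`-submodules of `K²` induced by a matrix. -/
def submoduleOrderIso (g : SL(2, K)) : Submodule O (Fin 2 → K) ≃o Submodule O (Fin 2 → K) :=
  Submodule.orderIsoMapComap ((Matrix.SpecialLinearGroup.toLin' g).restrictScalars O)

theorem mem_submoduleOrderIso {g : SL(2, K)} {L : Submodule O (Fin 2 → K)} {x : Fin 2 → K} :
    x ∈ submoduleOrderIso g L ↔ ∃ y ∈ L, (g : Matrix (Fin 2) (Fin 2) K).mulVec y = x :=
  Iff.rfl

theorem submoduleOrderIso_columnLattice (h : SL(2, K)) (g : Matrix (Fin 2) (Fin 2) K) :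
    submoduleOrderIso h (columnLattice O g) = columnLattice O ((h : Matrix (Fin 2) (Fin 2) K) * g) := by
  ext x
  rw [mem_submoduleOrderIso]
  constructor
  · rintro ⟨_, ⟨y, rfl⟩, rfl⟩
    exact ⟨y, (Matrix.mulVec_mulVec (algebraMap O K ∘ y) h.1 g).symm⟩
  · rintro ⟨y, rfl⟩
    exact ⟨_, ⟨y, rfl⟩, Matrix.mulVec_mulVec (algebraMap O K ∘ y) h.1 g⟩

instance (ϖ : O) : MulAction SL(2, K) (TreeVertex K ϖ) where
  smul g v := ⟨(submoduleOrderIso g v.1.1, v.1.2), by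
    obtain ⟨h, hdet, hL⟩ := v.2
    exact ⟨(g : Matrix (Fin 2) (Fin 2) K) * h, by rw [Matrix.det_mul, hdet, g.det_coe, one_mul],
      by rw [hL, submoduleOrderIso_columnLattice]⟩⟩
  one_smul v := by
    refine Subtype.ext (Prod.ext ?_ rfl)
    ext x
    refine mem_submoduleOrderIso.trans ?_
    simp
  mul_smul g h v := by
    refine Subtype.ext (Prod.ext ?_ rfl)
    ext x
    refine mem_submoduleOrderIso.trans ?_
    constructor
    · rintro ⟨y, hy, rfl⟩
      exact ⟨_, ⟨y, hy, rfl⟩, Matrix.mulVec_mulVec y g.1 h.1⟩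
    · rintro ⟨_, ⟨y, hy, rfl⟩, rfl⟩
      exact ⟨y, hy, (Matrix.mulVec_mulVec y g.1 h.1).symm⟩

/-- An element fixing the lattice `g` O² acts on the basis of columns of `g` by an integral matrix.
This is what bounds vertex stabilizers. -/
theorem TreeVertex.exists_conj_eq_map {ϖ : O} (v : TreeVertex K ϖ) (hϖ : algebraMap O K ϖ ≠ 0) :
    ∃ g : Matrix (Fin 2) (Fin 2) K, ∀ γ : SL(2, K), γ • v = v →
      ∃ B : Matrix (Fin 2) (Fin 2) O, (γ : Matrix (Fin 2) (Fin 2) K) =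
        g * B.map (algebraMap O K) * g⁻¹ := by
  obtain ⟨g, hdet, hL⟩ := v.2
  have hunit : IsUnit g.det := by
    rw [hdet]
    exact (pow_ne_zero _ hϖ).isUnit
  refine ⟨g, fun γ hγ => ?_⟩
  have hγL : columnLattice O ((γ : Matrix (Fin 2) (Fin 2) K) * g) = columnLattice O g := by
    rw [← submoduleOrderIso_columnLattice, ← hL]
    exact congrArg (fun u : TreeVertex K ϖ => u.1.1) hγ
  have hcol : ∀ l, ∃ y : Fin 2 → O, ∀ j, g j 0 * algebraMap O K (y 0) +
      g j 1 * algebraMap O K (y 1) = ((γ : Matrix (Fin 2) (Fin 2) K) * g) j l := by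
    intro l
    rw [← mem_columnLattice (x := fun j => ((γ : Matrix (Fin 2) (Fin 2) K) * g) j l), ← hγL,
      mem_columnLattice]
    refine ⟨Pi.single l 1, fun j => ?_⟩
    fin_cases l <;> simp
  choose B hB using hcol
  refine ⟨Matrix.of fun k l => B l k, ?_⟩
  have : (γ : Matrix (Fin 2) (Fin 2) K) * g =
      g * (Matrix.of fun k l => B l k).map (algebraMap O K) := by
    ext j l
    rw [← hB]
    simp [Matrix.mul_apply, Fin.sum_univ_two]
  rw [← this, Matrix.mul_assoc, Matrix.mul_nonsing_inv _ hunit, Matrix.mul_one]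

variable [IsDomain O] [IsDiscreteValuationRing O] [IsFractionRing O K]

/-- A subgroup of `SL(2, K)` containing `-1` which acts on the tree with finite vertex stabilizers,
and whose torsion elements have an odd power in `{1, -1}`, has a character taking the value `-1` at
`-1`. -/
theorem exists_character_of_finite_stabilizers {ϖ : O} (hϖ : Irreducible ϖ)
    (hneg : (-1 : SL(2, K)) ≠ 1) (Γ : Subgroup SL(2, K)) (hz : -1 ∈ Γ)
    (hfin : ∀ v : TreeVertex K ϖ, {γ : SL(2, K) | γ ∈ Γ ∧ γ • v = v}.Finite)
    (hodd : ∀ γ ∈ Γ, IsOfFinOrder γ → ∃ m, Odd m ∧ (γ ^ m = 1 ∨ γ ^ m = -1)) :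
    ∃ χ : Γ →* ℤˣ, χ ⟨-1, hz⟩ = -1 := by
  have hv : ∀ v : TreeVertex K ϖ, ∃ n c, HasNormalForm ϖ v.1.2 n c v.1.1 := fun v =>
    v.2.exists_hasNormalForm hϖ (by omega)
  choose lev c hnf using hv
  have htype : ∀ v : TreeVertex K ϖ, v.1.2 = 0 ∨ v.1.2 = 1 := fun v => by omega
  have hnf0 : ∀ v : TreeVertex K ϖ, v.1.2 = 0 → HasNormalForm ϖ 0 (lev v) (c v) v.1.1 :=
    fun v h => by simpa [h] using hnf v
  have hnf1 : ∀ v : TreeVertex K ϖ, v.1.2 = 1 → HasNormalForm ϖ 1 (lev v) (c v) v.1.1 :=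
    fun v h => by simpa [h] using hnf v
  -- Edges run from type 1 to type 0; the action preserves types, so no edge is inverted.
  let R : TreeVertex K ϖ → TreeVertex K ϖ → Prop := fun v w =>
    v.1.2 = 1 ∧ w.1.2 = 0 ∧ v.1.1 ⋖ w.1.1
  -- Descending passes from type 0, level `n + 1`, to type 1, level `n`, then to type 0, level `n`;
  -- this height drops by one each time.
  let ht : TreeVertex K ϖ → ℕ := fun v => 2 * lev v + (v.1.2 : ℕ)
  let z : Γ := ⟨-1, hz⟩
  have hneg_smul : ∀ v : TreeVertex K ϖ, z • v = v := by
    intro v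
    refine Subtype.ext (Prod.ext ?_ rfl)
    ext x
    refine mem_submoduleOrderIso.trans ?_
    have hmul : ∀ y : Fin 2 → K, ((-1 : SL(2, K)) : Matrix (Fin 2) (Fin 2) K).mulVec y = -y := by
      intro y
      rw [Matrix.SpecialLinearGroup.coe_neg, Matrix.SpecialLinearGroup.coe_one, Matrix.neg_mulVec,
        Matrix.one_mulVec]
    constructor
    · rintro ⟨y, hy, rfl⟩
      exact (hmul y).symm ▸ neg_mem hy
    · intro hx
      exact ⟨-x, neg_mem hx, (hmul _).trans (neg_neg x)⟩
  have hzz : z * z = 1 := Subtype.ext (by simp [z])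
  have hz1 : z ≠ 1 := fun h => hneg (congrArg Subtype.val h)
  suffices hex : ∃ χ : Γ →* ℤˣ, ∀ (v : TreeVertex K ϖ) (g : Γ), g • v = v →
      χ g = oddOrderSign g by
    obtain ⟨χ, hχ⟩ := hex
    refine ⟨χ, ?_⟩
    have v₀ : TreeVertex K ϖ := ⟨(columnLattice O 1, 0), 1, by simp, rfl⟩
    rw [hχ v₀ z (hneg_smul v₀)]
    exact oddOrderSign_eq_neg_one hzz hz1 (pow_one z)
  refine exists_character_of_tree oddOrderSign oddOrderSign_conj ?_ R ?_ ?_ ht ?_ ?_ ?_ ?_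
  · intro v g h hg hh
    let S := MulAction.stabilizer Γ v
    have hS : Finite S := by
      refine Set.Finite.of_injOn (f := fun s : S => ((s : Γ) : SL(2, K))) (s := Set.univ)
        (t := {γ : SL(2, K) | γ ∈ Γ ∧ γ • v = v}) ?_ ?_ (hfin v) |> Set.finite_univ_iff.mp
      · exact fun s _ => ⟨s.1.2, s.2⟩
      · exact fun s _ t _ hst => Subtype.ext (Subtype.ext hst)
    have key := oddOrderSign_mul (Γ := S) (z := ⟨z, hneg_smul v⟩)
      (Subgroup.mem_center_iff.mpr fun g => Subtype.ext (Subtype.ext (by simp [z])))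
      (Subtype.ext hzz) (fun h => hz1 (congrArg Subtype.val h)) (fun g => ?_) ⟨g, hg⟩ ⟨h, hh⟩
    · rw [← oddOrderSign_map S.subtype S.subtype_injective,
        ← oddOrderSign_map S.subtype S.subtype_injective,
        ← oddOrderSign_map S.subtype S.subtype_injective] at key
      exact key
    · have hfo : IsOfFinOrder ((g : Γ) : SL(2, K)) :=
        (Γ.subtype.comp S.subtype).isOfFinOrder (isOfFinOrder_of_finite g)
      obtain ⟨m, hm, h | h⟩ := hodd _ g.1.2 hfo
      · exact ⟨m, hm, .inl (Subtype.ext (Subtype.ext h))⟩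
      · exact ⟨m, hm, .inr (Subtype.ext (Subtype.ext h))⟩
  · rintro g v w ⟨h1, h0, hvw⟩
    exact ⟨h1, h0, (apply_covBy_apply_iff (submoduleOrderIso (g : SL(2, K)))).mpr hvw⟩
  · rintro v w ⟨h1, -⟩ ⟨-, h0, -⟩
    rw [h1] at h0
    exact one_ne_zero h0
  · intro v w hv hw
    have hv0 : v.1.2 = 0 := by simp only [ht] at hv; omega
    have hw0 : w.1.2 = 0 := by simp only [ht] at hw; omega
    have hv' := hnf0 v hv0
    have hw' := hnf0 w hw0
    rw [show lev v = 0 by simp only [ht] at hv; omega] at hv'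
    rw [show lev w = 0 by simp only [ht] at hw; omega] at hw'
    exact Subtype.ext (Prod.ext (hv'.eq_of_level_zero hw') (hv0.trans hw0.symm))
  · intro v hv
    rcases htype v with h | h
    · obtain ⟨n, hn⟩ : ∃ n, lev v = n + 1 :=
        Nat.exists_eq_succ_of_ne_zero (by simp only [ht, h] at hv; simpa using hv)
      have hv' := hnf0 v h
      rw [hn] at hv'
      obtain ⟨M, hM, hML⟩ := hv'.exists_covBy hϖ
      let w : TreeVertex K ϖ := ⟨(M, 1), hM.isLatticeOfType hϖ.ne_zero⟩
      have hw : lev w = n := (hnf1 w rfl).level_unique hϖ hM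
      refine ⟨w, .inr ⟨rfl, h, hML⟩, ?_⟩
      simp only [ht, hw, hn, h, w]
      simp
      omega
    · obtain ⟨L, hL, hML⟩ := (hnf1 v h).exists_covBy_of_type_one hϖ
      let w : TreeVertex K ϖ := ⟨(L, 0), hL.isLatticeOfType hϖ.ne_zero⟩
      have hw : lev w = lev v := (hnf0 w rfl).level_unique hϖ hL
      refine ⟨w, .inl ⟨h, rfl, hML⟩, ?_⟩
      simp only [ht, hw, h, w]
      simp
  · intro v w w' hw hw' hlt hlt'
    simp only [ht] at hlt hlt'
    rcases htype v with h | h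
    · have hnR : ∀ u, ¬ R v u := fun u hu => zero_ne_one (h.symm.trans hu.1)
      obtain ⟨hw1, -, hwv⟩ := hw.resolve_left (hnR w)
      obtain ⟨hw1', -, hwv'⟩ := hw'.resolve_left (hnR w')
      rw [h, hw1] at hlt
      rw [h, hw1'] at hlt'
      refine Subtype.ext (Prod.ext ?_ (hw1.trans hw1'.symm))
      exact lower_neighbour_unique hϖ (hnf0 v h) (hnf1 w hw1) (hnf1 w' hw1') hwv hwv'
        (by simp at hlt; omega) (by simp at hlt'; omega)
    · have hnR : ∀ u, ¬ R u v := fun u hu => zero_ne_one (hu.2.1.symm.trans h)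
      obtain ⟨-, hw0, hwv⟩ := hw.resolve_right (hnR w)
      obtain ⟨-, hw0', hwv'⟩ := hw'.resolve_right (hnR w')
      rw [h, hw0] at hlt
      rw [h, hw0'] at hlt'
      refine Subtype.ext (Prod.ext ?_ (hw0.trans hw0'.symm))
      exact lower_neighbour_unique_of_type_one hϖ (hnf1 v h) (hnf0 w hw0) (hnf0 w' hw0') hwv hwv'
        (by simp at hlt; omega) (by simp at hlt'; omega)
  · rintro v w ⟨h1, h0, -⟩ heq
    simp only [ht, h1, h0] at heq
    simp at heq
    omega

end Tree

/-! ### Central extension, discreteness and compactness over a local field. -/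

section LocalField

open ValuativeRel

variable {K : Type*} [Field K]

theorem mem_center_SL_two_iff {g : SL(2, K)} :
    g ∈ Subgroup.center SL(2, K) ↔ g = 1 ∨ g = -1 := by
  constructor
  · intro h
    obtain ⟨r, hr, hg⟩ := Matrix.SpecialLinearGroup.mem_center_iff.mp h
    have hr2 : r ^ 2 = 1 := by simpa using hr
    rcases sq_eq_one_iff.mp hr2 with rfl | rfl
    · exact .inl (Subtype.ext (by simp [← hg]))
    · refine .inr (Subtype.ext ?_)
      rw [← hg, map_neg, map_one, Matrix.SpecialLinearGroup.coe_neg,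
        Matrix.SpecialLinearGroup.coe_one]
  · rintro (rfl | rfl)
    · exact one_mem _
    · exact Subgroup.mem_center_iff.mpr fun h => by simp

theorem projSL_eq_iff {g h : SL(2, K)} : projSL K g = projSL K h ↔ h = g ∨ h = -g := by
  rw [projSL, QuotientGroup.mk'_apply, QuotientGroup.mk'_apply, QuotientGroup.eq,
    mem_center_SL_two_iff, inv_mul_eq_iff_eq_mul, inv_mul_eq_iff_eq_mul]
  simp

theorem projSL_eq_one_iff {g : SL(2, K)} : projSL K g = 1 ↔ g = 1 ∨ g = -1 := by
  rw [← mem_center_SL_two_iff]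
  exact QuotientGroup.eq_one_iff g

theorem neg_one_ne_one_SL_two (hK : ringChar K ≠ 2) : (-1 : SL(2, K)) ≠ 1 := by
  intro h
  have := congrFun (congrFun (congrArg Subtype.val h) 0) 0
  exact Ring.neg_one_ne_one_of_char_ne_two hK (by simpa using this)

/-- Such a matrix equals its inverse, which is its adjugate; as 2 is invertible, comparing entries
forces it to be scalar. -/
theorem eq_one_or_eq_neg_one_of_sq_eq_one (hK : ringChar K ≠ 2) {A : SL(2, K)} (h : A ^ 2 = 1) :
    A = 1 ∨ A = -1 := by
  have hinv : A⁻¹ = A := by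
    rw [inv_eq_iff_mul_eq_one, ← pow_two, h]
  rw [Matrix.SpecialLinearGroup.SL2_inv_expl] at hinv
  have hentry : ∀ i j, !![A 1 1, -A 0 1; -A 1 0, A 0 0] i j = A i j := fun i j =>
    congrFun (congrFun (congrArg Subtype.val hinv) i) j
  have h2 : (2 : K) ≠ 0 := Ring.two_ne_zero hK
  have hoff : ∀ x : K, -x = x → x = 0 := fun x hx =>
    (mul_eq_zero.mp (by linear_combination -hx : (2 : K) * x = 0)).resolve_left h2
  have h01 : A 0 1 = 0 := hoff _ (hentry 0 1)
  have h10 : A 1 0 = 0 := hoff _ (hentry 1 0)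
  have hdiag : A 1 1 = A 0 0 := hentry 0 0
  have hdet := A.det_coe
  rw [Matrix.det_fin_two, h01, hdiag] at hdet
  rcases sq_eq_one_iff.mp (by linear_combination hdet : A 0 0 ^ 2 = 1) with h0 | h0
  · left
    ext i j
    fin_cases i <;> fin_cases j <;> simp [h01, h10, hdiag, h0]
  · right
    ext i j
    fin_cases i <;> fin_cases j <;> simp [h01, h10, hdiag, h0]

/-- A lift is an injective homomorphism, and `-1` is the only involution of `SL(2, K)`. -/
theorem LiftsAlong.hasNoTwoTorsion (hK : ringChar K ≠ 2) {G : Subgroup PSL(2, K)} (h : LiftsAlong (projSL K) G) :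
    HasNoTwoTorsion G := by
  obtain ⟨φ, hφ⟩ := h
  intro g hg hord
  have hg2 : (⟨g, hg⟩ : G) ^ 2 = 1 := Subtype.ext (by simpa [hord] using pow_orderOf_eq_one g)
  have hφ2 : φ ⟨g, hg⟩ ^ 2 = 1 := by rw [← map_pow, hg2, map_one]
  have hcases : φ ⟨g, hg⟩ = 1 ∨ φ ⟨g, hg⟩ = -1 :=
    eq_one_or_eq_neg_one_of_sq_eq_one hK hφ2
  have : g = 1 := by
    rw [← projSL_eq_one_iff, hφ] at hcases
    exact hcases
  rw [this, orderOf_one] at hord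
  omega

/-- A character of the preimage of `G` taking the value `-1` at `-1` singles out a lift of each
element of `G`. -/
theorem liftsAlong_of_character {G : Subgroup PSL(2, K)}
    (hz : -1 ∈ G.comap (projSL K)) (χ : G.comap (projSL K) →* ℤˣ) (hχ : χ ⟨-1, hz⟩ = -1) :
    LiftsAlong (projSL K) G := by
  have hex : ∀ g : G, ∃ γ : G.comap (projSL K), projSL K γ = g ∧ χ γ = 1 := by
    rintro ⟨g, hg⟩
    obtain ⟨γ, rfl⟩ := QuotientGroup.mk'_surjective _ g
    rcases Int.units_eq_one_or (χ ⟨γ, hg⟩) with h | h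
    · exact ⟨⟨γ, hg⟩, rfl, h⟩
    · refine ⟨⟨-1, hz⟩ * ⟨γ, hg⟩, projSL_eq_iff.mpr (.inr (by simp)), ?_⟩
      rw [map_mul, hχ, h]
      rfl
  have huniq : ∀ γ δ : G.comap (projSL K), projSL K γ = projSL K δ → χ γ = 1 → χ δ = 1 → γ = δ := by
    intro γ δ h hγ hδ
    rcases projSL_eq_iff.mp h with h | h
    · exact Subtype.ext h.symm
    · have : δ = ⟨-1, hz⟩ * γ := Subtype.ext (by simp [h])
      rw [this, map_mul, hχ, hγ] at hδ
      exact absurd hδ (by decide)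
  choose f hf hf1 using hex
  refine ⟨MonoidHom.mk' (fun g => (f g : SL(2, K))) fun g h => ?_, hf⟩
  rw [← Subgroup.coe_mul]
  congr 1
  refine huniq _ _ ?_ (hf1 _) (by rw [map_mul, hf1, hf1, one_mul])
  rw [hf, Subgroup.coe_mul, Subgroup.coe_mul, map_mul, hf, hf]

/-- The image of `γ` in `G` has odd order, since otherwise half that order would be the exponent of
a power of order 2. -/
theorem exists_odd_pow_eq {G : Subgroup PSL(2, K)} (hG : HasNoTwoTorsion G) {γ : SL(2, K)}
    (hγ : γ ∈ G.comap (projSL K)) (hfin : IsOfFinOrder γ) :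
    ∃ m, Odd m ∧ (γ ^ m = 1 ∨ γ ^ m = -1) := by
  have hfin' : 0 < orderOf (projSL K γ) := ((projSL K).isOfFinOrder hfin).orderOf_pos
  refine ⟨orderOf (projSL K γ), ?_, ?_⟩
  · rw [← Nat.not_even_iff_odd]
    rintro ⟨k, hk⟩
    refine hG _ (G.pow_mem hγ k) ?_
    rw [orderOf_pow_of_dvd (by omega) ⟨2, by omega⟩, hk]
    exact Nat.div_eq_of_eq_mul_left (by omega) (by omega)
  · rw [← projSL_eq_one_iff, map_pow, pow_orderOf_eq_one]

variable [ValuativeRel K] [TopologicalSpace K] [IsNonarchimedeanLocalField K]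

variable (K) in
theorem t2Space_of_isNonarchimedeanLocalField : T2Space K := by
  let := IsTopologicalAddGroup.rightUniformSpace K
  have := isUniformAddGroup_of_addCommGroup (G := K)
  infer_instance

theorem discreteTopology_comap_projSL (G : Subgroup PSL(2, K)) [DiscreteTopology G] :
    DiscreteTopology (G.comap (projSL K)) := by
  have := t2Space_of_isNonarchimedeanLocalField K
  obtain ⟨U, hU, hUG⟩ := isOpen_induced_iff.mp (isOpen_discrete ({1} : Set G))
  have hcont : Continuous fun γ : G.comap (projSL K) => projSL K γ :=
    QuotientGroup.continuous_mk.comp continuous_subtype_val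
  refine discreteTopology_of_isOpen_singleton_one ?_
  -- The preimage of `U` in the group is `{1, -1}`; the point -1 is removed from it, unless it
  -- coincides with 1.
  have hopen : IsOpen ((fun γ : G.comap (projSL K) => projSL K γ) ⁻¹' U ∩
      {γ | (γ : SL(2, K)) = -1 ∧ γ ≠ 1}ᶜ) := by
    refine (hU.preimage hcont).inter (Set.Finite.isClosed ?_).isOpen_compl
    exact Set.Subsingleton.finite fun γ hγ δ hδ => Subtype.ext (hγ.1.trans hδ.1.symm)
  convert hopen
  ext γ
  have hγU : projSL K γ ∈ U ↔ projSL K γ = 1 := by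
    have := Set.ext_iff.mp hUG ⟨projSL K γ, γ.2⟩
    simpa [Subtype.ext_iff] using this
  simp only [Set.mem_singleton_iff, Set.mem_inter_iff, Set.mem_preimage, hγU, projSL_eq_one_iff,
    Set.mem_compl_iff, Set.mem_ofPred_eq]
  constructor
  · rintro rfl
    exact ⟨.inl rfl, fun h => h.2 rfl⟩
  · rintro ⟨h | h, h'⟩
    · exact Subtype.ext h
    · by_contra hne
      exact h' ⟨h, hne⟩

/-- A vertex stabilizer in SL₂(K) lies in a conjugate of the integral matrices, which is compact
since 𝒪[K] is; a discrete subgroup is closed and meets a compact set in finitely many points. -/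
theorem finite_stabilizer {ϖ : 𝒪[K]} (hϖ : ϖ ≠ 0) (Γ : Subgroup SL(2, K)) [DiscreteTopology Γ]
    (v : TreeVertex K ϖ) : {γ : SL(2, K) | γ ∈ Γ ∧ γ • v = v}.Finite := by
  have := t2Space_of_isNonarchimedeanLocalField K
  obtain ⟨g, hg⟩ := v.exists_conj_eq_map
    ((map_ne_zero_iff _ (IsFractionRing.injective 𝒪[K] K)).mpr hϖ)
  have : CompactSpace (Matrix (Fin 2) (Fin 2) 𝒪[K]) :=
    inferInstanceAs (CompactSpace (Fin 2 → Fin 2 → 𝒪[K]))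
  have hcont : Continuous fun B : Matrix (Fin 2) (Fin 2) 𝒪[K] =>
      g * B.map (algebraMap 𝒪[K] K) * g⁻¹ := by
    have : Continuous (algebraMap 𝒪[K] K) := continuous_subtype_val
    fun_prop
  have hrange : IsCompact {A : Matrix (Fin 2) (Fin 2) K | ∃ B : Matrix (Fin 2) (Fin 2) 𝒪[K],
      A = g * B.map (algebraMap 𝒪[K] K) * g⁻¹} := by
    simpa only [Set.range, eq_comm] using isCompact_range hcont
  have hcompact : IsCompact {γ : SL(2, K) | ∃ B : Matrix (Fin 2) (Fin 2) 𝒪[K],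
      (γ : Matrix (Fin 2) (Fin 2) K) = g * B.map (algebraMap 𝒪[K] K) * g⁻¹} :=
    Matrix.SpecialLinearGroup.isClosedEmbedding_val.isCompact_preimage hrange
  have : T2Space SL(2, K) :=
    Matrix.SpecialLinearGroup.isClosedEmbedding_val.isEmbedding.t2Space
  have hclosed : IsClosed (Γ : Set SL(2, K)) := Subgroup.isClosed_of_discrete
  have hdisc : IsDiscrete (Γ : Set SL(2, K)) := SetLike.isDiscrete_iff_discreteTopology.mpr ‹_›
  refine ((hcompact.inter_left hclosed).finite (hdisc.mono Set.inter_subset_left)).subset ?_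
  exact fun γ hγ => ⟨hγ.1, hg γ hγ.2⟩

end LocalField

/-- `PSL(2, K)` carries the quotient topology of `SL(2, K)`, which carries the subspace topology
of the `2 × 2` matrices over `K`; the subgroup `G` is discrete in the subspace topology. -/
theorem theoremA (K : Type*) [Field K] [ValuativeRel K] [TopologicalSpace K]
    [IsNonarchimedeanLocalField K] (hK : ringChar K ≠ 2)
    (G : Subgroup PSL(2, K)) (hG : DiscreteTopology G) :
    LiftsAlong (projSL K) G ↔ HasNoTwoTorsion G := by
  refine ⟨LiftsAlong.hasNoTwoTorsion hK, fun htors => ?_⟩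
  obtain ⟨ϖ, hϖ⟩ := IsDiscreteValuationRing.exists_irreducible (ValuativeRel.valuation K).integer
  have hz : -1 ∈ G.comap (projSL K) := by
    rw [Subgroup.mem_comap, projSL_eq_one_iff.mpr (.inr rfl)]
    exact one_mem G
  have := discreteTopology_comap_projSL G
  obtain ⟨χ, hχ⟩ := exists_character_of_finite_stabilizers hϖ (neg_one_ne_one_SL_two hK)
    (G.comap (projSL K)) hz (fun v => finite_stabilizer hϖ.ne_zero _ v)
    fun γ hγ hfin => exists_odd_pow_eq htors hγ hfin
  exact liftsAlong_of_character hz χ hχ
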